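/- **Setting.** Let $H\ge 0$ and let $C\in\mathbb{R}$, $C\neq 0$, be *feasible*, i.e. the polynomial $p_C(x)=(H^2+1)x^2-(1+2HC)x+C^2$ has real roots $C_1\ge C_2\ge 0$ (counted with multiplicity). Put $$p=\sqrt{\tfrac{C_1-C_2}{C_1}}\in[0,1),\qquad \Xi=\sqrt{(H^2+1)C_1},\qquad k=\tfrac{C_1-C_2}{C_1-1}.$$ Let $\operatorname{am}_p$ be the inverse function of $\varphi\mapsto\int_0^\varphi \frac{dx}{\sqrt{1-p^2\sin^2x}}$, let $\operatorname{sn}_p=\sin\circ\operatorname{am}_p$ and $\operatorname{dn}_p=\sqrt{1-p^2\operatorname{sn}_p^2}$, let $\Pi_p^{k}(s)=\int_0^s\frac{du}{1-k\operatorname{sn}_p^2(u)}$, and let $$F_p=\int_0^{\pi/2}\frac{dx}{\sqrt{1-p^2\sin^2x}},\qquad \Pi_p(k)=\int_0^{\pi/2}\frac{dx}{(1-k\sin^2x)\sqrt{1-p^2\sin^2x}}$$ be the complete elliptic integrals of the first and third kind. The Delaunay-type surface in $\mathbb{S}^3\subset\mathbb{R}^4$ with parameters $(H,C)$ is $$f(\theta,t)=\bigl(r(t)\cos\theta,\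 r(t)\sin\theta,\ \sqrt{1-r(t)^2}\cos\psi(t),\ \sqrt{1-r(t)^2}\sin\psi(t)\bigr),$$ $$r(t)=\sqrt{C_1}\,\operatorname{dn}_p(\Xi t),\qquad \psi(t)=Ht-\frac{C-H}{C_1-1}\,\frac1\Xi\,\Pi_p^{k}(\Xi t),$$ and its profile curve is $c(t)=f(0,t)$. (One has $C_1=1$ only if $C=H$; in that case the terms with the factor $\frac{C-H}{C_1-1}$ are omitted, here and below, so that $\psi(t)=Ht$.) **Theorem.** Suppose that for some $n\in\mathbb{N}$ $$\left|\frac{n}{\Xi}\left(F_p\,H-\frac{C-H}{C_1-1}\,\Pi_p\!\left(\frac{C_1-C_2}{C_1-1}\right)\right)\right|=\pi .$$ Then the profile curve is periodic: there is $T>0$ with $c(t+T)=c(t)$ for all $t\in\mathbb{R}$. If moreover $C<0$, then $T$ can be chosen such that in addition $c$ is injective on $[0,T)$ (the profile curve has no self-intersections) and the surface is an embedded torus of revolution in $\mathbb{S}^3$ of constant mean curvature $H$: $f$ is a smooth immersion into $\mathbb{S}^3$ that descends to an embedding of the torus $\mathbb{R}/2\pi\mathbb{Z}\times\mathbb{R}/T\mathbb{Z}$,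 shifting $\theta$ by $\varphi$ acts as the rotation by $\varphi$ in the plane of the first two coordinates, and the mean curvature with respect to a suitable smooth unit normal field on this torus is identically $H$. -/

import Mathlib

open Real Set Topology
open scoped ContDiff

noncomputable section

namespace DelaunayS3

/-! ### Elliptic integrals and Jacobi elliptic functions (modulus `0 ≤ p < 1`) -/

/-- Incomplete elliptic integral of the first kind with modulus `p`, as a function of the
amplitude: `F(φ, p) = ∫₀^φ dx / √(1 - p² sin² x)`. -/
def ellipticF (p φ : ℝ) : ℝ :=
  ∫ x in (0 : ℝ)..φ, 1 / √(1 - p ^ 2 * sin x ^ 2)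

/-- Complete elliptic integral of the first kind, `F_p = F(π/2, p)`. -/
def completeF (p : ℝ) : ℝ := ellipticF p (π / 2)

/-- Jacobi amplitude `am_p`, the inverse function of `φ ↦ F(φ, p)`
(a bijection of `ℝ` for `0 ≤ p < 1`). -/
def jacobiAm (p : ℝ) : ℝ → ℝ := Function.invFun (ellipticF p)

/-- Jacobi elliptic function `sn_p = sin ∘ am_p`. -/
def jacobiSn (p s : ℝ) : ℝ := sin (jacobiAm p s)

/-- Jacobi elliptic function `dn_p = √(1 - p² sn_p²)`. -/
def jacobiDn (p s : ℝ) : ℝ := √(1 - p ^ 2 * jacobiSn p s ^ 2)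

/-- Incomplete elliptic integral of the third kind with modulus `p` and parameter `k`:
`Π_p^k(s) = ∫₀^s du / (1 - k sn_p²(u))`. -/
def ellipticPi (p k s : ℝ) : ℝ :=
  ∫ u in (0 : ℝ)..s, 1 / (1 - k * jacobiSn p u ^ 2)

/-- Complete elliptic integral of the third kind,
`Π_p(k) = ∫₀^{π/2} dx / ((1 - k sin² x) √(1 - p² sin² x))`. -/
def completePi (p k : ℝ) : ℝ :=
  ∫ x in (0 : ℝ)..(π / 2), 1 / ((1 - k * sin x ^ 2) * √(1 - p ^ 2 * sin x ^ 2))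

/-! ### Delaunay-type surfaces in the three-sphere -/

/-- `C` is feasible for the mean curvature `H`: the polynomial
`p_C(x) = (H² + 1) x² - (1 + 2 H C) x + C²` has the real roots `C₁ ≥ C₂ ≥ 0`
(listed with multiplicity). -/
structure IsFeasible (H C C₁ C₂ : ℝ) : Prop where
  factor : ∀ x : ℝ, (H ^ 2 + 1) * x ^ 2 - (1 + 2 * H * C) * x + C ^ 2
    = (H ^ 2 + 1) * (x - C₁) * (x - C₂)
  le : C₂ ≤ C₁
  nonneg : 0 ≤ C₂

/-- The modulus `p`, with `p² = (C₁ - C₂) / C₁`. -/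
def modulus (C₁ C₂ : ℝ) : ℝ := √((C₁ - C₂) / C₁)

/-- `Ξ = √((H² + 1) C₁)`. -/
def Xi (H C₁ : ℝ) : ℝ := √((H ^ 2 + 1) * C₁)

/-- The radius function `r(t) = √C₁ dn_p(Ξ t)`. -/
def radius (H C₁ C₂ t : ℝ) : ℝ :=
  √C₁ * jacobiDn (modulus C₁ C₂) (Xi H C₁ * t)

/-- The angle function
`ψ(t) = H t - (C - H)/(C₁ - 1) · (1/Ξ) · Π_p^k(Ξ t)`, `k = (C₁ - C₂)/(C₁ - 1)`.
For feasible `C` one has `C₁ = 1` exactly when `C = H`; the quotient `(C - H)/(C₁ - 1)` is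
then `0`, so that `ψ(t) = H t`, which is the angle function in this special case. -/
def angle (H C C₁ C₂ t : ℝ) : ℝ :=
  H * t - (C - H) / (C₁ - 1) * (1 / Xi H C₁)
    * ellipticPi (modulus C₁ C₂) ((C₁ - C₂) / (C₁ - 1)) (Xi H C₁ * t)

/-- The parametrization `(θ, t) ↦ (r cos θ, r sin θ, √(1 - r²) cos ψ, √(1 - r²) sin ψ)`. -/
def surface (H C C₁ C₂ : ℝ) (x : ℝ × ℝ) : EuclideanSpace ℝ (Fin 4) :=
  !₂[radius H C₁ C₂ x.2 * cos x.1,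
     radius H C₁ C₂ x.2 * sin x.1,
     √(1 - radius H C₁ C₂ x.2 ^ 2) * cos (angle H C C₁ C₂ x.2),
     √(1 - radius H C₁ C₂ x.2 ^ 2) * sin (angle H C C₁ C₂ x.2)]

/-- The planar profile curve, i.e. the parameter line `θ = 0`. -/
def profile (H C C₁ C₂ t : ℝ) : EuclideanSpace ℝ (Fin 4) := surface H C C₁ C₂ (0, t)

/-! ### Embedded constant mean curvature tori of revolution -/

/-- `N` is a smooth unit normal field, within the unit sphere `S³ ⊂ ℝ⁴`, along the map `f`
with values in `S³`. -/
structure IsUnitNormal (f N : ℝ × ℝ → EuclideanSpace ℝ (Fin 4)) : Prop where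
  smooth : ContDiff ℝ ∞ N
  norm_eq : ∀ x, ‖N x‖ = 1
  tangent_sphere : ∀ x, inner ℝ (N x) (f x) = 0
  normal : ∀ x v, inner ℝ (N x) (fderiv ℝ f x v) = 0

/-- Mean curvature `(e G - 2 m F + g E) / (2 (E G - F²))` of an immersion `f` into `S³` with
respect to the unit normal field `N`, where `E, F, G` and `e, m, g` are the coefficients of
the first fundamental form `⟨df, df⟩` and the second fundamental form `-⟨df, dN⟩`. -/
def meanCurvature (f N : ℝ × ℝ → EuclideanSpace ℝ (Fin 4)) (x : ℝ × ℝ) : ℝ :=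
  let fu := fderiv ℝ f x (1, 0)
  let fv := fderiv ℝ f x (0, 1)
  let Nu := fderiv ℝ N x (1, 0)
  let Nv := fderiv ℝ N x (0, 1)
  let E : ℝ := inner ℝ fu fu
  let F : ℝ := inner ℝ fu fv
  let G : ℝ := inner ℝ fv fv
  let e : ℝ := -inner ℝ fu Nu
  let m : ℝ := -inner ℝ fu Nv
  let g : ℝ := -inner ℝ fv Nv
  (e * G - 2 * m * F + g * E) / (2 * (E * G - F ^ 2))

/-- Rotation of `ℝ⁴` by the angle `φ` in the plane of the first two coordinates. -/
def rotation (φ : ℝ) (y : EuclideanSpace ℝ (Fin 4)) : EuclideanSpace ℝ (Fin 4) :=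
  !₂[cos φ * y 0 - sin φ * y 1, sin φ * y 0 + cos φ * y 1, y 2, y 3]

/-- The map `f : ℝ² → ℝ⁴` parametrizes an embedded torus of revolution in `S³` of constant
mean curvature `H`: it is a smooth immersion into `S³`, it descends to a topological embedding
of the torus `ℝ/2πℤ × ℝ/Tℤ`, the first variable is the angle of rotation, and for some smooth
unit normal field on the torus the mean curvature is `H` everywhere. -/
structure IsEmbeddedCMCTorusOfRevolution (f : ℝ × ℝ → EuclideanSpace ℝ (Fin 4)) (T H : ℝ) :
    Prop where
  smooth : ContDiff ℝ ∞ f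
  mem_sphere : ∀ x, f x ∈ Metric.sphere (0 : EuclideanSpace ℝ (Fin 4)) 1
  immersion : ∀ x, Function.Injective (fderiv ℝ f x)
  embedding : ∃ F : AddCircle (2 * π) × AddCircle T → EuclideanSpace ℝ (Fin 4),
    IsEmbedding F ∧
      ∀ θ t : ℝ, F ((θ : AddCircle (2 * π)), (t : AddCircle T)) = f (θ, t)
  revolution : ∀ φ θ t : ℝ, f (θ + φ, t) = rotation φ (f (θ, t))
  cmc : ∃ N : ℝ × ℝ → EuclideanSpace ℝ (Fin 4), IsUnitNormal f N ∧
    (∀ θ t : ℝ, N (θ + 2 * π, t) = N (θ, t) ∧ N (θ, t + T) = N (θ, t)) ∧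
    ∀ x, meanCurvature f N x = H

end DelaunayS3

end

noncomputable section

namespace DelaunayS3

/-! ### Integrals of `π`-periodic functions that are symmetric about `π / 2` -/

/-! Periodicity. Raising the amplitude by `π` adds `2 F_p` to the first elliptic integral and `2
Π_p(k)` to the third, since both integrands are `π`-periodic and symmetric about `π / 2`. Hence `r`
has period `2 F_p / Ξ`, and over that period `ψ` changes by a fixed amount (`angle_add`). The
closing condition says that `n` such periods turn `ψ` by `±2π`; take `T = 2 n F_p / Ξ`.

Geometry. For `C ≠ H`, `r'² = -p_C(r²)` and `ψ' = (C - H r²) / (1 - r²)`. These two equations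
(`IsDelaunayProfile`) make the parametrization conformal with factor `r²` and give an explicit unit
normal. Its second fundamental form has diagonal entries `H r² - C` and `H r² + C`, so the mean
curvature is `H`.

Embeddedness. If `C < 0 ≤ H` then `ψ' < 0`, so `ψ` winds exactly once around the circle during `T`.
The last two coordinates then determine `t` modulo `T`, the first two determine `θ` modulo `2π`, and
a continuous injection of the compact torus is an embedding. -/

theorem integral_zero_add_pi {g : ℝ → ℝ} (hg : Continuous g) (hper : Function.Periodic g π)
    (hsymm : ∀ x, g (π - x) = g x) (φ : ℝ) :
    ∫ x in (0 : ℝ)..(φ + π), g x = (∫ x in (0 : ℝ)..φ, g x) + 2 * ∫ x in (0 : ℝ)..(π / 2), g x := by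
  have hi : ∀ a b, IntervalIntegrable g MeasureTheory.volume a b := fun a b =>
    hg.intervalIntegrable a b
  have h1 := intervalIntegral.integral_add_adjacent_intervals (hi 0 φ) (hi φ (φ + π))
  have h2 := hper.intervalIntegral_add_eq φ 0
  have h3 := intervalIntegral.integral_add_adjacent_intervals (hi 0 (π / 2)) (hi (π / 2) π)
  have h4 : ∫ x in (0 : ℝ)..(π / 2), g (π - x) = ∫ x in (π / 2)..π, g x := by
    rw [intervalIntegral.integral_comp_sub_left (fun x => g x) π]
    congr 1 <;> ring
  simp only [hsymm] at h4
  rw [zero_add] at h2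
  linarith

/-! ### The Jacobi amplitude -/

section Modulus

variable {p : ℝ}

theorem one_sub_sq_mul_sin_sq_pos (hp0 : 0 ≤ p) (hp1 : p < 1) (x : ℝ) :
    0 < 1 - p ^ 2 * sin x ^ 2 := by
  nlinarith [sin_sq_le_one x, sq_nonneg p, mul_le_of_le_one_right (sq_nonneg p) (sin_sq_le_one x)]

theorem continuous_integrandF (hp0 : 0 ≤ p) (hp1 : p < 1) :
    Continuous fun x => 1 / √(1 - p ^ 2 * sin x ^ 2) :=
  continuous_const.div (by fun_prop) fun x =>
    (sqrt_pos.2 (one_sub_sq_mul_sin_sq_pos hp0 hp1 x)).ne'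

theorem one_le_integrandF (hp0 : 0 ≤ p) (hp1 : p < 1) (x : ℝ) :
    1 ≤ 1 / √(1 - p ^ 2 * sin x ^ 2) := by
  rw [le_div_iff₀ (sqrt_pos.2 (one_sub_sq_mul_sin_sq_pos hp0 hp1 x)), one_mul, sqrt_le_one]
  nlinarith [mul_nonneg (sq_nonneg p) (sq_nonneg (sin x))]

theorem hasDerivAt_ellipticF (hp0 : 0 ≤ p) (hp1 : p < 1) (φ : ℝ) :
    HasDerivAt (ellipticF p) (1 / √(1 - p ^ 2 * sin φ ^ 2)) φ :=
  (continuous_integrandF hp0 hp1).integral_hasStrictDerivAt 0 φ |>.hasDerivAt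

theorem strictMono_ellipticF (hp0 : 0 ≤ p) (hp1 : p < 1) : StrictMono (ellipticF p) :=
  strictMono_of_hasDerivAt_pos (hasDerivAt_ellipticF hp0 hp1) fun x =>
    zero_lt_one.trans_le (one_le_integrandF hp0 hp1 x)

theorem continuous_ellipticF (hp0 : 0 ≤ p) (hp1 : p < 1) : Continuous (ellipticF p) :=
  continuous_iff_continuousAt.2 fun x => (hasDerivAt_ellipticF hp0 hp1 x).continuousAt

theorem ellipticF_zero : ellipticF p 0 = 0 := by simp [ellipticF]

/-- The integrand is at least `1`. The resulting linear growth at both ends makes `ellipticF p`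
surjective, so `invFun` is a genuine inverse. -/
theorem monotone_ellipticF_sub_id (hp0 : 0 ≤ p) (hp1 : p < 1) :
    Monotone fun φ => ellipticF p φ - φ :=
  monotone_of_hasDerivAt_nonneg
    (fun x => (hasDerivAt_ellipticF hp0 hp1 x).sub (hasDerivAt_id x))
    fun x => sub_nonneg.2 (one_le_integrandF hp0 hp1 x)

theorem surjective_ellipticF (hp0 : 0 ≤ p) (hp1 : p < 1) :
    Function.Surjective (ellipticF p) := by
  have hm := monotone_ellipticF_sub_id hp0 hp1
  refine (continuous_ellipticF hp0 hp1).surjective ?_ ?_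
  · refine Filter.tendsto_atTop_mono' _ ?_ Filter.tendsto_id
    filter_upwards [Filter.eventually_ge_atTop 0] with x hx
    have := hm hx
    simp only [ellipticF_zero] at this
    simp only [id]; linarith
  · refine Filter.tendsto_atBot_mono' _ ?_ Filter.tendsto_id
    filter_upwards [Filter.eventually_le_atBot 0] with x hx
    have := hm hx
    simp only [ellipticF_zero] at this
    simp only [id]; linarith

theorem ellipticF_jacobiAm (hp0 : 0 ≤ p) (hp1 : p < 1) (s : ℝ) :
    ellipticF p (jacobiAm p s) = s :=
  Function.rightInverse_invFun (surjective_ellipticF hp0 hp1) s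

theorem jacobiAm_ellipticF (hp0 : 0 ≤ p) (hp1 : p < 1) (φ : ℝ) :
    jacobiAm p (ellipticF p φ) = φ :=
  Function.leftInverse_invFun (strictMono_ellipticF hp0 hp1).injective φ

theorem continuous_jacobiAm (hp0 : 0 ≤ p) (hp1 : p < 1) : Continuous (jacobiAm p) := by
  let e := (strictMono_ellipticF hp0 hp1).orderIsoOfSurjective _ (surjective_ellipticF hp0 hp1)
  have h : jacobiAm p = e.symm := by
    ext s
    rw [OrderIso.eq_symm_apply]
    exact ellipticF_jacobiAm hp0 hp1 s
  rw [h]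
  exact e.symm.continuous

theorem jacobiDn_eq (s : ℝ) : jacobiDn p s = √(1 - p ^ 2 * sin (jacobiAm p s) ^ 2) := rfl

theorem jacobiDn_pos (hp0 : 0 ≤ p) (hp1 : p < 1) (s : ℝ) : 0 < jacobiDn p s :=
  sqrt_pos.2 (one_sub_sq_mul_sin_sq_pos hp0 hp1 _)

theorem jacobiDn_sq (hp0 : 0 ≤ p) (hp1 : p < 1) (s : ℝ) :
    jacobiDn p s ^ 2 = 1 - p ^ 2 * sin (jacobiAm p s) ^ 2 :=
  sq_sqrt (one_sub_sq_mul_sin_sq_pos hp0 hp1 _).le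

theorem hasDerivAt_jacobiAm (hp0 : 0 ≤ p) (hp1 : p < 1) (s : ℝ) :
    HasDerivAt (jacobiAm p) (jacobiDn p s) s := by
  have h := (hasDerivAt_ellipticF hp0 hp1 (jacobiAm p s)).of_local_left_inverse
    (continuous_jacobiAm hp0 hp1).continuousAt
    (one_div_pos.2 (jacobiDn_pos hp0 hp1 s)).ne'
    (Filter.Eventually.of_forall (ellipticF_jacobiAm hp0 hp1))
  simpa [jacobiDn_eq] using h

/-- Bootstrapping: `am' = √(1 - p² sin² am)` is as regular as `am` itself, because the radicand
stays positive. -/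
theorem contDiff_jacobiAm (hp0 : 0 ≤ p) (hp1 : p < 1) : ContDiff ℝ ∞ (jacobiAm p) := by
  have hd : deriv (jacobiAm p) = fun s => √(1 - p ^ 2 * sin (jacobiAm p s) ^ 2) :=
    funext fun s => (hasDerivAt_jacobiAm hp0 hp1 s).deriv
  rw [contDiff_infty]
  intro n
  induction n with
  | zero => exact contDiff_zero.2 (continuous_jacobiAm hp0 hp1)
  | succ n ih =>
    rw [Nat.cast_succ, contDiff_succ_iff_deriv]
    refine ⟨fun s => (hasDerivAt_jacobiAm hp0 hp1 s).differentiableAt, by simp, ?_⟩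
    rw [hd]
    exact (contDiff_const.sub (contDiff_const.mul (ih.sin.pow 2))).sqrt fun s =>
      (one_sub_sq_mul_sin_sq_pos hp0 hp1 _).ne'

theorem contDiff_jacobiDn (hp0 : 0 ≤ p) (hp1 : p < 1) : ContDiff ℝ ∞ (jacobiDn p) :=
  (contDiff_const.sub (contDiff_const.mul ((contDiff_jacobiAm hp0 hp1).sin.pow 2))).sqrt fun _ =>
    (one_sub_sq_mul_sin_sq_pos hp0 hp1 _).ne'

theorem hasDerivAt_jacobiDn (hp0 : 0 ≤ p) (hp1 : p < 1) (s : ℝ) :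
    HasDerivAt (jacobiDn p) (-p ^ 2 * sin (jacobiAm p s) * cos (jacobiAm p s)) s := by
  have h := ((((hasDerivAt_jacobiAm hp0 hp1 s).sin.pow 2).const_mul (p ^ 2)).const_sub 1).sqrt
    (one_sub_sq_mul_sin_sq_pos hp0 hp1 (jacobiAm p s)).ne'
  refine h.congr_deriv ?_
  have := (jacobiDn_pos hp0 hp1 s).ne'
  change _ / (2 * jacobiDn p s) = _
  field_simp
  ring

theorem completeF_pos (hp0 : 0 ≤ p) (hp1 : p < 1) : 0 < completeF p := by
  have := strictMono_ellipticF hp0 hp1 (half_pos pi_pos)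
  rwa [ellipticF_zero] at this

theorem ellipticF_add_pi (hp0 : 0 ≤ p) (hp1 : p < 1) (φ : ℝ) :
    ellipticF p (φ + π) = ellipticF p φ + 2 * completeF p :=
  integral_zero_add_pi (continuous_integrandF hp0 hp1) (fun x => by simp [sin_add_pi])
    (fun x => by simp [sin_pi_sub]) φ

theorem jacobiAm_add_two_completeF (hp0 : 0 ≤ p) (hp1 : p < 1) (s : ℝ) :
    jacobiAm p (s + 2 * completeF p) = jacobiAm p s + π := by
  rw [← jacobiAm_ellipticF hp0 hp1 (jacobiAm p s + π), ellipticF_add_pi hp0 hp1,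
    ellipticF_jacobiAm hp0 hp1]

theorem periodic_jacobiDn (hp0 : 0 ≤ p) (hp1 : p < 1) :
    Function.Periodic (jacobiDn p) (2 * completeF p) := fun s => by
  simp [jacobiDn_eq, jacobiAm_add_two_completeF hp0 hp1, sin_add_pi]

/-! ### The elliptic integral of the third kind -/

variable {k : ℝ}

theorem one_sub_mul_sin_sq_pos (hk : k ≤ 0) (x : ℝ) : 0 < 1 - k * sin x ^ 2 := by
  nlinarith [mul_nonneg (neg_nonneg.2 hk) (sq_nonneg (sin x))]

theorem hasDerivAt_ellipticPi (hp0 : 0 ≤ p) (hp1 : p < 1) (hk : k ≤ 0) (s : ℝ) :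
    HasDerivAt (ellipticPi p k) (1 / (1 - k * jacobiSn p s ^ 2)) s := by
  have hc : Continuous fun u => 1 / (1 - k * jacobiSn p u ^ 2) := by
    refine continuous_const.div ?_ fun u => (one_sub_mul_sin_sq_pos hk _).ne'
    have := continuous_jacobiAm hp0 hp1
    unfold jacobiSn
    fun_prop
  exact (hc.integral_hasStrictDerivAt 0 s).hasDerivAt

/-- Substitution `u = F(x, p)`. In the amplitude variable, a shift of `s` by `2 F_p` becomes a shift
by `π`. -/
theorem ellipticPi_eq (hp0 : 0 ≤ p) (hp1 : p < 1) (hk : k ≤ 0) (s : ℝ) :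
    ellipticPi p k s = ∫ x in (0 : ℝ)..(jacobiAm p s),
      1 / ((1 - k * sin x ^ 2) * √(1 - p ^ 2 * sin x ^ 2)) := by
  have hc : Continuous fun u => 1 / (1 - k * jacobiSn p u ^ 2) := by
    refine continuous_const.div ?_ fun u => (one_sub_mul_sin_sq_pos hk _).ne'
    have := continuous_jacobiAm hp0 hp1
    unfold jacobiSn
    fun_prop
  have h := intervalIntegral.integral_comp_mul_deriv (a := 0) (b := jacobiAm p s)
    (fun x _ => hasDerivAt_ellipticF hp0 hp1 x) (continuous_integrandF hp0 hp1).continuousOn hc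
  rw [ellipticF_zero, ellipticF_jacobiAm hp0 hp1] at h
  rw [ellipticPi, ← h]
  refine intervalIntegral.integral_congr fun x _ => ?_
  simp only [Function.comp, jacobiSn, jacobiAm_ellipticF hp0 hp1]
  rw [one_div_mul_one_div]

theorem ellipticPi_add_two_completeF (hp0 : 0 ≤ p) (hp1 : p < 1) (hk : k ≤ 0) (s : ℝ) :
    ellipticPi p k (s + 2 * completeF p) = ellipticPi p k s + 2 * completePi p k := by
  rw [ellipticPi_eq hp0 hp1 hk, ellipticPi_eq hp0 hp1 hk, jacobiAm_add_two_completeF hp0 hp1]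
  refine integral_zero_add_pi ?_ (fun x => by simp [sin_add_pi]) (fun x => by simp [sin_pi_sub]) _
  exact continuous_const.div (by fun_prop) fun x => (mul_pos (one_sub_mul_sin_sq_pos hk x)
    (sqrt_pos.2 (one_sub_sq_mul_sin_sq_pos hp0 hp1 x))).ne'

end Modulus

/-! ### Vectors of `ℝ⁴` in a rotating frame -/

/-- The vector `(a e^{iθ}, (b + i c) e^{iψ})` of `ℂ² = ℝ⁴`. -/
def frameVector (θ ψ a b c : ℝ) : EuclideanSpace ℝ (Fin 4) :=
  !₂[a * cos θ, a * sin θ, b * cos ψ - c * sin ψ, b * sin ψ + c * cos ψ]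

/-- The unit vector `(i e^{iθ}, 0)` of `ℂ² = ℝ⁴`. -/
def rotationVector (θ : ℝ) : EuclideanSpace ℝ (Fin 4) := !₂[-sin θ, cos θ, 0, 0]

theorem inner_frameVector (θ ψ a b c a' b' c' : ℝ) :
    inner ℝ (frameVector θ ψ a b c) (frameVector θ ψ a' b' c') = a * a' + b * b' + c * c' := by
  simp only [frameVector, PiLp.inner_apply, Fin.sum_univ_four, RCLike.inner_apply, conj_trivial,
    Matrix.cons_val]
  linear_combination (a * a') * sin_sq_add_cos_sq θ + (b * b' + c * c') * sin_sq_add_cos_sq ψ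

theorem inner_frameVector_rotationVector (θ ψ a b c : ℝ) :
    inner ℝ (frameVector θ ψ a b c) (rotationVector θ) = 0 := by
  simp only [frameVector, rotationVector, PiLp.inner_apply, Fin.sum_univ_four, RCLike.inner_apply,
    conj_trivial, Matrix.cons_val]
  ring

theorem inner_rotationVector (θ : ℝ) :
    inner ℝ (rotationVector θ) (rotationVector θ) = (1 : ℝ) := by
  simp only [rotationVector, PiLp.inner_apply, Fin.sum_univ_four, RCLike.inner_apply,
    conj_trivial, Matrix.cons_val]
  linear_combination sin_sq_add_cos_sq θ

theorem norm_frameVector_sq (θ ψ a b c : ℝ) :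
    ‖frameVector θ ψ a b c‖ ^ 2 = a ^ 2 + b ^ 2 + c ^ 2 := by
  rw [← real_inner_self_eq_norm_sq, inner_frameVector]
  ring

/-- Differentiating `e^{iψ}` contributes `iψ'(b + ic)`, so the `t`-derivative stays in the same
frame and all later inner products are taken componentwise. -/
theorem hasFDerivAt_frameVector {ψ a b c : ℝ → ℝ} {ψ' a' b' c' : ℝ} {x : ℝ × ℝ}
    (hψ : HasDerivAt ψ ψ' x.2) (ha : HasDerivAt a a' x.2) (hb : HasDerivAt b b' x.2)
    (hc : HasDerivAt c c' x.2) :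
    HasFDerivAt (fun y : ℝ × ℝ => frameVector y.1 (ψ y.2) (a y.2) (b y.2) (c y.2))
      ((ContinuousLinearMap.fst ℝ ℝ ℝ).smulRight (a x.2 • rotationVector x.1) +
        (ContinuousLinearMap.snd ℝ ℝ ℝ).smulRight
          (frameVector x.1 (ψ x.2) a' (b' - c x.2 * ψ') (c' + b x.2 * ψ'))) x := by
  have h1 : HasFDerivAt (Prod.fst : ℝ × ℝ → ℝ) (ContinuousLinearMap.fst ℝ ℝ ℝ) x := hasFDerivAt_fst
  have h2 : HasFDerivAt (Prod.snd : ℝ × ℝ → ℝ) (ContinuousLinearMap.snd ℝ ℝ ℝ) x := hasFDerivAt_snd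
  have ha' := ha.comp_hasFDerivAt x h2
  have hb' := hb.comp_hasFDerivAt x h2
  have hc' := hc.comp_hasFDerivAt x h2
  have hψ' := hψ.comp_hasFDerivAt x h2
  rw [← hasFDerivWithinAt_univ, hasFDerivWithinAt_euclidean]
  intro i
  rw [hasFDerivWithinAt_univ]
  fin_cases i
  · refine (ha'.mul h1.cos).congr_fderiv ?_
    ext <;> simp [frameVector, rotationVector]
    ring
  · refine (ha'.mul h1.sin).congr_fderiv ?_
    ext <;> simp [frameVector, rotationVector]
    ring
  · refine ((hb'.mul hψ'.cos).sub (hc'.mul hψ'.sin)).congr_fderiv ?_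
    ext <;> simp [frameVector, rotationVector]
    ring
  · refine ((hb'.mul hψ'.sin).add (hc'.mul hψ'.cos)).congr_fderiv ?_
    ext <;> simp [frameVector, rotationVector]
    ring

theorem contDiff_frameVector {ψ a b c : ℝ → ℝ} (hψ : ContDiff ℝ ∞ ψ) (ha : ContDiff ℝ ∞ a)
    (hb : ContDiff ℝ ∞ b) (hc : ContDiff ℝ ∞ c) :
    ContDiff ℝ ∞ fun y : ℝ × ℝ => frameVector y.1 (ψ y.2) (a y.2) (b y.2) (c y.2) := by
  rw [contDiff_euclidean]
  intro i
  fin_cases i <;> simp only [frameVector, PiLp.toLp_apply] <;> simp <;> fun_prop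

/-! ### Surfaces of revolution with the Delaunay profile -/

/-- The functions `r`, `ψ` form the profile of a conformally parametrized surface of revolution
in `S³` of constant mean curvature `H`; the function `ρ` is the derivative of `r`. -/
structure IsDelaunayProfile (H C : ℝ) (r ρ ψ : ℝ → ℝ) : Prop where
  contDiff_r : ContDiff ℝ ∞ r
  contDiff_ψ : ContDiff ℝ ∞ ψ
  pos : ∀ t, 0 < r t
  lt_one : ∀ t, r t < 1
  deriv_r : ∀ t, HasDerivAt r (ρ t) t
  deriv_ρ : ∀ t, HasDerivAt ρ ((1 + 2 * H * C - 2 * (H ^ 2 + 1) * r t ^ 2) * r t) t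
  ρ_sq : ∀ t, ρ t ^ 2 = (1 + 2 * H * C) * r t ^ 2 - (H ^ 2 + 1) * r t ^ 4 - C ^ 2
  deriv_ψ : ∀ t, HasDerivAt ψ ((C - H * r t ^ 2) / (1 - r t ^ 2)) t

/-- The surface of revolution with profile `(r, ψ)`. -/
def revolutionSurface (r ψ : ℝ → ℝ) (x : ℝ × ℝ) : EuclideanSpace ℝ (Fin 4) :=
  frameVector x.1 (ψ x.2) (r x.2) (√(1 - r x.2 ^ 2)) 0

/-- The unit normal field of a Delaunay surface of revolution. -/
def revolutionNormal (H C : ℝ) (r ρ ψ : ℝ → ℝ) (x : ℝ × ℝ) : EuclideanSpace ℝ (Fin 4) :=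
  frameVector x.1 (ψ x.2) ((C - H * r x.2 ^ 2) / r x.2)
    (-(C - H * r x.2 ^ 2) / √(1 - r x.2 ^ 2)) (-ρ x.2 / (r x.2 * √(1 - r x.2 ^ 2)))

namespace IsDelaunayProfile

variable {H C : ℝ} {r ρ ψ : ℝ → ℝ}

theorem one_sub_sq_pos (h : IsDelaunayProfile H C r ρ ψ) (t : ℝ) : 0 < 1 - r t ^ 2 := by
  nlinarith [h.pos t, h.lt_one t]

theorem contDiff_sqrt (h : IsDelaunayProfile H C r ρ ψ) :
    ContDiff ℝ ∞ fun t => √(1 - r t ^ 2) :=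
  (contDiff_const.sub (h.contDiff_r.pow 2)).sqrt fun t => (h.one_sub_sq_pos t).ne'

theorem contDiff_ρ (h : IsDelaunayProfile H C r ρ ψ) : ContDiff ℝ ∞ ρ := by
  have := (contDiff_infty_iff_deriv.1 h.contDiff_r).2
  rwa [show deriv r = ρ from funext fun t => (h.deriv_r t).deriv] at this

theorem contDiff_surface (h : IsDelaunayProfile H C r ρ ψ) :
    ContDiff ℝ ∞ (revolutionSurface r ψ) :=
  contDiff_frameVector h.contDiff_ψ h.contDiff_r h.contDiff_sqrt contDiff_const

theorem contDiff_normal (h : IsDelaunayProfile H C r ρ ψ) :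
    ContDiff ℝ ∞ (revolutionNormal H C r ρ ψ) := by
  have hq : ContDiff ℝ ∞ fun t => C - H * r t ^ 2 :=
    contDiff_const.sub (contDiff_const.mul (h.contDiff_r.pow 2))
  have hs : ∀ t, √(1 - r t ^ 2) ≠ 0 := fun t => (sqrt_pos.2 (h.one_sub_sq_pos t)).ne'
  exact contDiff_frameVector h.contDiff_ψ (hq.div h.contDiff_r fun t => (h.pos t).ne')
    (hq.neg.div h.contDiff_sqrt hs) (h.contDiff_ρ.neg.div (h.contDiff_r.mul h.contDiff_sqrt)
      fun t => mul_ne_zero (h.pos t).ne' (hs t))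

theorem hasDerivAt_sqrt (h : IsDelaunayProfile H C r ρ ψ) (t : ℝ) :
    HasDerivAt (fun t => √(1 - r t ^ 2)) (-(r t * ρ t) / √(1 - r t ^ 2)) t := by
  have h1 := (((h.deriv_r t).pow 2).const_sub 1).sqrt (h.one_sub_sq_pos t).ne'
  refine h1.congr_deriv ?_
  have := (sqrt_pos.2 (h.one_sub_sq_pos t)).ne'
  simp only [Pi.pow_apply]
  field_simp
  ring

theorem hasFDerivAt_surface (h : IsDelaunayProfile H C r ρ ψ) (x : ℝ × ℝ) :
    HasFDerivAt (revolutionSurface r ψ)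
      ((ContinuousLinearMap.fst ℝ ℝ ℝ).smulRight (r x.2 • rotationVector x.1) +
        (ContinuousLinearMap.snd ℝ ℝ ℝ).smulRight
          (frameVector x.1 (ψ x.2) (ρ x.2) (-(r x.2 * ρ x.2) / √(1 - r x.2 ^ 2))
            ((C - H * r x.2 ^ 2) / √(1 - r x.2 ^ 2)))) x := by
  have h1 := hasFDerivAt_frameVector (h.deriv_ψ x.2) (h.deriv_r x.2) (h.hasDerivAt_sqrt x.2)
    (hasDerivAt_const x.2 (0 : ℝ))
  refine h1.congr_fderiv ?_
  have hs := (sqrt_pos.2 (h.one_sub_sq_pos x.2)).ne'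
  have hs2 := sq_sqrt (h.one_sub_sq_pos x.2).le
  congr 3
  · ring
  · generalize √(1 - r x.2 ^ 2) = s at *
    rw [← hs2]
    field_simp
    ring

/-- The components of the `t`-derivative are left existential: the mean curvature needs them only
through the coefficient `g = -⟨f_t, N_t⟩`. -/
theorem hasFDerivAt_normal (h : IsDelaunayProfile H C r ρ ψ) (x : ℝ × ℝ) :
    ∃ a' b' c' : ℝ,
      HasFDerivAt (revolutionNormal H C r ρ ψ)
        ((ContinuousLinearMap.fst ℝ ℝ ℝ).smulRight
            (((C - H * r x.2 ^ 2) / r x.2) • rotationVector x.1) +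
          (ContinuousLinearMap.snd ℝ ℝ ℝ).smulRight (frameVector x.1 (ψ x.2) a' b' c')) x ∧
      -(ρ x.2 * a' + -(r x.2 * ρ x.2) / √(1 - r x.2 ^ 2) * b' +
        (C - H * r x.2 ^ 2) / √(1 - r x.2 ^ 2) * c') = H * r x.2 ^ 2 + C := by
  have hr := (h.pos x.2).ne'
  have hσ := h.one_sub_sq_pos x.2
  have hs := (sqrt_pos.2 hσ).ne'
  have hs2 := sq_sqrt hσ.le
  have hq := ((h.deriv_r x.2).pow 2).const_mul H |>.const_sub C
  have ha := hq.div (h.deriv_r x.2) hr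
  have hb := hq.neg.div (h.hasDerivAt_sqrt x.2) hs
  have hc := (h.deriv_ρ x.2).neg.div ((h.deriv_r x.2).mul (h.hasDerivAt_sqrt x.2))
    (mul_ne_zero hr hs)
  refine ⟨_, _, _, hasFDerivAt_frameVector (h.deriv_ψ x.2) ha hb hc, ?_⟩
  have hρ := h.ρ_sq x.2
  simp only [Pi.pow_apply, Pi.neg_apply, Pi.div_apply, Pi.mul_apply]
  generalize ρ x.2 = ρ at *
  generalize r x.2 = r at *
  generalize √(1 - r ^ 2) = s at *
  rw [← hs2]
  clear ha hb hc hq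
  push_cast
  field_simp
  -- With `s² = 1 - r²` and the first integral for `ρ²`, only a polynomial identity in `r` remains.
  rw [show s ^ 4 = (s ^ 2) ^ 2 by ring, hs2, hρ]
  ring

theorem norm_surface (h : IsDelaunayProfile H C r ρ ψ) (x : ℝ × ℝ) :
    ‖revolutionSurface r ψ x‖ = 1 := by
  have h1 : ‖revolutionSurface r ψ x‖ ^ 2 = 1 := by
    rw [revolutionSurface, norm_frameVector_sq, sq_sqrt (h.one_sub_sq_pos x.2).le]
    ring
  exact (pow_eq_one_iff_of_nonneg (norm_nonneg _) two_ne_zero).1 h1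

theorem norm_normal (h : IsDelaunayProfile H C r ρ ψ) (x : ℝ × ℝ) :
    ‖revolutionNormal H C r ρ ψ x‖ = 1 := by
  have h1 : ‖revolutionNormal H C r ρ ψ x‖ ^ 2 = 1 := by
    have hr := (h.pos x.2).ne'
    have hσ := h.one_sub_sq_pos x.2
    rw [revolutionNormal, norm_frameVector_sq, div_pow, div_pow, div_pow, mul_pow, sq_sqrt hσ.le,
      neg_sq, neg_sq, h.ρ_sq]
    have := hσ.ne'
    field_simp
    ring
  exact (pow_eq_one_iff_of_nonneg (norm_nonneg _) two_ne_zero).1 h1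

/-- The parametrization is conformal with conformal factor `r²`. -/
theorem inner_deriv_self (h : IsDelaunayProfile H C r ρ ψ) (t : ℝ) :
    ρ t * ρ t + -(r t * ρ t) / √(1 - r t ^ 2) * (-(r t * ρ t) / √(1 - r t ^ 2)) +
      (C - H * r t ^ 2) / √(1 - r t ^ 2) * ((C - H * r t ^ 2) / √(1 - r t ^ 2)) = r t ^ 2 := by
  have hσ := h.one_sub_sq_pos t
  have hs := (sqrt_pos.2 hσ).ne'
  have hs2 := sq_sqrt hσ.le
  have hρ := h.ρ_sq t
  field_simp
  rw [hs2]
  linear_combination hρ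

theorem injective_fderiv_surface (h : IsDelaunayProfile H C r ρ ψ) (x : ℝ × ℝ) :
    Function.Injective (fderiv ℝ (revolutionSurface r ψ) x) := by
  rw [(h.hasFDerivAt_surface x).fderiv, injective_iff_map_eq_zero]
  intro v hv
  have hr := (h.pos x.2).ne'
  -- The two partial derivatives are orthogonal; pairing with their directions gives `r v₁ = 0` and
  -- `r² v₂ = 0`.
  have h1 := congrArg (fun w => inner ℝ w (rotationVector x.1)) hv
  have h2 := congrArg (fun w => inner ℝ (frameVector x.1 (ψ x.2) (ρ x.2)
    (-(r x.2 * ρ x.2) / √(1 - r x.2 ^ 2)) ((C - H * r x.2 ^ 2) / √(1 - r x.2 ^ 2))) w) hv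
  simp only [add_apply, ContinuousLinearMap.smulRight_apply,
    ContinuousLinearMap.coe_fst', ContinuousLinearMap.coe_snd', inner_add_left, inner_add_right,
    inner_smul_left, inner_smul_right, conj_trivial, inner_frameVector_rotationVector,
    inner_rotationVector, inner_frameVector, inner_zero_left, inner_zero_right,
    h.inner_deriv_self, mul_zero, add_zero, zero_add, mul_one] at h1 h2
  ext
  · simpa [hr] using h1
  · simpa [hr] using h2

theorem isUnitNormal (h : IsDelaunayProfile H C r ρ ψ) :
    IsUnitNormal (revolutionSurface r ψ) (revolutionNormal H C r ρ ψ) where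
  smooth := h.contDiff_normal
  norm_eq := h.norm_normal
  tangent_sphere x := by
    have hr := (h.pos x.2).ne'
    have hs := (sqrt_pos.2 (h.one_sub_sq_pos x.2)).ne'
    rw [revolutionSurface, revolutionNormal, inner_frameVector]
    field_simp
    ring
  normal x v := by
    have hr := (h.pos x.2).ne'
    have hσ := h.one_sub_sq_pos x.2
    have hs := (sqrt_pos.2 hσ).ne'
    have hs2 := sq_sqrt hσ.le
    rw [(h.hasFDerivAt_surface x).fderiv, revolutionNormal]
    simp only [add_apply, ContinuousLinearMap.smulRight_apply,
      ContinuousLinearMap.coe_fst', ContinuousLinearMap.coe_snd', inner_add_right,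
      inner_smul_right, inner_frameVector_rotationVector, inner_frameVector]
    field_simp
    rw [hs2]
    ring

theorem meanCurvature_eq (h : IsDelaunayProfile H C r ρ ψ) (x : ℝ × ℝ) :
    meanCurvature (revolutionSurface r ψ) (revolutionNormal H C r ρ ψ) x = H := by
  obtain ⟨a', b', c', hN, hg⟩ := h.hasFDerivAt_normal x
  have hr := (h.pos x.2).ne'
  simp only [meanCurvature, (h.hasFDerivAt_surface x).fderiv, hN.fderiv,
    add_apply, ContinuousLinearMap.smulRight_apply,
    ContinuousLinearMap.coe_fst', ContinuousLinearMap.coe_snd', one_smul, zero_smul, add_zero,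
    zero_add, inner_smul_left, inner_smul_right, conj_trivial, inner_rotationVector,
    inner_frameVector, h.inner_deriv_self, hg,
    real_inner_comm (frameVector _ _ _ _ _) (rotationVector _), inner_frameVector_rotationVector]
  field_simp
  ring

end IsDelaunayProfile

/-! ### Embeddings of tori -/

theorem addCircle_coe_eq_coe_iff_exists {T t t' : ℝ} :
    (t : AddCircle T) = t' ↔ ∃ m : ℤ, t - t' = m * T := by
  rw [QuotientAddGroup.eq_iff_sub_mem, AddSubgroup.mem_zmultiples_iff]
  simp [eq_comm]

/-- The induced map is continuous by the quotient topology, and a continuous injection from a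
compact space to a Hausdorff space is a closed embedding. -/
theorem exists_isEmbedding_torus {E : Type*} [TopologicalSpace E] [T2Space E] {S T : ℝ}
    (hS : 0 < S) (hT : 0 < T) {f : ℝ × ℝ → E} (hf : Continuous f)
    (hf1 : ∀ θ t, f (θ + S, t) = f (θ, t)) (hf2 : ∀ θ t, f (θ, t + T) = f (θ, t))
    (hinj : ∀ θ t θ' t', f (θ, t) = f (θ', t') →
      (θ : AddCircle S) = θ' ∧ (t : AddCircle T) = t') :
    ∃ F : AddCircle S × AddCircle T → E, IsEmbedding F ∧
      ∀ θ t : ℝ, F ((θ : AddCircle S), (t : AddCircle T)) = f (θ, t) := by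
  have : Fact (0 < S) := ⟨hS⟩
  have : Fact (0 < T) := ⟨hT⟩
  have hmod : ∀ θ t θ' t' : ℝ, (θ : AddCircle S) = θ' → (t : AddCircle T) = t' →
      f (θ, t) = f (θ', t') := by
    intro θ t θ' t' hθ ht
    obtain ⟨k, hk⟩ := addCircle_coe_eq_coe_iff_exists.1 hθ
    obtain ⟨m, hm⟩ := addCircle_coe_eq_coe_iff_exists.1 ht
    have h1 : Function.Periodic (fun θ => f (θ, t)) S := fun θ => hf1 θ t
    have h2 : Function.Periodic (fun t => f (θ', t)) T := fun t => hf2 θ' t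
    rw [show θ = θ' + k * S by linarith, show t = t' + m * T by linarith]
    rw [show t = t' + m * T by linarith] at h1
    exact (h1.int_mul k θ').trans (h2.int_mul m t')
  let F : AddCircle S × AddCircle T → E := fun y => f (y.1.out, y.2.out)
  have hF : ∀ θ t : ℝ, F ((θ : AddCircle S), (t : AddCircle T)) = f (θ, t) := fun θ t =>
    hmod _ _ _ _ (Quotient.out_eq _) (Quotient.out_eq _)
  have hq : IsOpenQuotientMap (Prod.map ((↑) : ℝ → AddCircle S) ((↑) : ℝ → AddCircle T)) :=
    QuotientAddGroup.isOpenQuotientMap_mk.prodMap QuotientAddGroup.isOpenQuotientMap_mk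
  have hFc : Continuous F := by
    rw [← hq.continuous_comp_iff]
    exact hf.congr fun x => (hF x.1 x.2).symm
  refine ⟨F, (hFc.isClosedEmbedding ?_).isEmbedding, hF⟩
  intro y y' hy
  obtain ⟨⟨θ, t⟩, rfl⟩ := hq.surjective y
  obtain ⟨⟨θ', t'⟩, rfl⟩ := hq.surjective y'
  simp only [Prod.map, hF] at hy ⊢
  exact Prod.ext_iff.2 (hinj _ _ _ _ hy)

/-! ### Closed Delaunay surfaces -/

theorem eq_of_mul_cos_eq {a a' x x' : ℝ} (ha : 0 < a) (ha' : 0 < a')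
    (hc : a * cos x = a' * cos x') (hs : a * sin x = a' * sin x') :
    a = a' ∧ ∃ k : ℤ, x - x' = 2 * π * k := by
  have h : a = a' := by
    refine (pow_left_inj₀ ha.le ha'.le two_ne_zero).1 ?_
    have h1 := congrArg (· ^ 2) hc
    have h2 := congrArg (· ^ 2) hs
    simp only [mul_pow] at h1 h2
    linear_combination h1 + h2 - a ^ 2 * sin_sq_add_cos_sq x + a' ^ 2 * sin_sq_add_cos_sq x'
  subst h
  exact ⟨rfl, Real.Angle.angle_eq_iff_two_pi_dvd_sub.1 (Real.Angle.cos_sin_inj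
    (mul_left_cancel₀ ha.ne' hc) (mul_left_cancel₀ ha.ne' hs))⟩

namespace IsDelaunayProfile

variable {H C T : ℝ} {r ρ ψ : ℝ → ℝ}

theorem strictAnti_ψ (h : IsDelaunayProfile H C r ρ ψ) (hH : 0 ≤ H) (hC : C < 0) :
    StrictAnti ψ :=
  strictAnti_of_hasDerivAt_neg h.deriv_ψ fun t =>
    div_neg_of_neg_of_pos (by nlinarith [mul_nonneg hH (sq_nonneg (r t))]) (h.one_sub_sq_pos t)

theorem periodic_ρ (h : IsDelaunayProfile H C r ρ ψ) (hr : Function.Periodic r T) :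
    Function.Periodic ρ T := fun t => by
  have h1 := (h.deriv_r (t + T)).comp_add_const t T
  rw [show (fun x => r (x + T)) = r from funext hr] at h1
  exact h1.unique (h.deriv_r t)

theorem eq_of_surface_eq (h : IsDelaunayProfile H C r ρ ψ) (hanti : StrictAnti ψ) (hT : T ≠ 0)
    (hψ : ∀ t, ψ (t + T) = ψ t - 2 * π) {θ t θ' t' : ℝ}
    (heq : revolutionSurface r ψ (θ, t) = revolutionSurface r ψ (θ', t')) :
    (θ : AddCircle (2 * π)) = θ' ∧ (t : AddCircle T) = t' := by
  have h0 := congrArg (fun v => v 0) heq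
  have h1 := congrArg (fun v => v 1) heq
  have h2 := congrArg (fun v => v 2) heq
  have h3 := congrArg (fun v => v 3) heq
  simp [revolutionSurface, frameVector] at h0 h1 h2 h3
  obtain ⟨-, k, hk⟩ := eq_of_mul_cos_eq (h.pos t) (h.pos t') h0 h1
  obtain ⟨-, m, hm⟩ := eq_of_mul_cos_eq (sqrt_pos.2 (h.one_sub_sq_pos t))
    (sqrt_pos.2 (h.one_sub_sq_pos t')) h2 h3
  rw [addCircle_coe_eq_coe_iff_exists, addCircle_coe_eq_coe_iff_exists]
  -- The sign is reversed because `ψ` drops by `2π` when `t` grows by `T`.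
  refine ⟨⟨k, by linarith⟩, -m, ?_⟩
  -- Adding the compensating linear term yields a periodic function, which gives the effect on `ψ`
  -- of arbitrary integer multiples of `T`.
  have hper : Function.Periodic (fun t => ψ t + t * (2 * π / T)) T := fun t => by
    simp only [hψ]
    field_simp
    ring
  have h4 := hper.int_mul (-m) t'
  have h5 : (t' + ((-m : ℤ) : ℝ) * T) * (2 * π / T) = t' * (2 * π / T) - 2 * π * m := by
    push_cast
    field_simp
    ring
  have h6 : t = t' + ((-m : ℤ) : ℝ) * T := hanti.injective (by linarith)
  linarith

theorem isEmbeddedCMCTorusOfRevolution (h : IsDelaunayProfile H C r ρ ψ) (hanti : StrictAnti ψ)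
    (hT : 0 < T) (hr : Function.Periodic r T) (hψ : ∀ t, ψ (t + T) = ψ t - 2 * π) :
    IsEmbeddedCMCTorusOfRevolution (revolutionSurface r ψ) T H where
  smooth := h.contDiff_surface
  mem_sphere x := by simpa using h.norm_surface x
  immersion := h.injective_fderiv_surface
  embedding := exists_isEmbedding_torus two_pi_pos hT h.contDiff_surface.continuous
    (fun θ t => by simp [revolutionSurface, frameVector])
    (fun θ t => by simp [revolutionSurface, frameVector, hr t, hψ])
    fun _ _ _ _ => h.eq_of_surface_eq hanti hT.ne' hψ
  revolution φ θ t := by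
    ext i
    fin_cases i <;> simp [revolutionSurface, frameVector, rotation, cos_add, sin_add] <;> ring
  cmc := ⟨revolutionNormal H C r ρ ψ, h.isUnitNormal, fun θ t =>
    ⟨by simp [revolutionNormal, frameVector],
      by simp [revolutionNormal, frameVector, hr t, hψ, h.periodic_ρ hr t]⟩, h.meanCurvature_eq⟩

end IsDelaunayProfile

/-! ### The roots of the polynomial `p_C` -/

namespace IsFeasible

variable {H C C₁ C₂ : ℝ}

theorem sum_eq (h : IsFeasible H C C₁ C₂) : (H ^ 2 + 1) * (C₁ + C₂) = 1 + 2 * H * C := by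
  linarith [h.factor 0, h.factor 1]

theorem prod_eq (h : IsFeasible H C C₁ C₂) : (H ^ 2 + 1) * (C₁ * C₂) = C ^ 2 := by
  linarith [h.factor 0]

/-- Both sides are `p_C(1)`. This controls the position of the roots relative to `1`. -/
theorem one_sub_mul_one_sub (h : IsFeasible H C C₁ C₂) :
    (H ^ 2 + 1) * ((1 - C₁) * (1 - C₂)) = (C - H) ^ 2 := by
  linarith [h.factor 1]

theorem snd_pos (h : IsFeasible H C C₁ C₂) (hC : C ≠ 0) : 0 < C₂ := by
  refine h.nonneg.lt_of_ne fun h0 => ?_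
  have := h.prod_eq
  rw [← h0] at this
  exact hC (pow_eq_zero_iff two_ne_zero |>.1 (by linarith))

theorem fst_pos (h : IsFeasible H C C₁ C₂) (hC : C ≠ 0) : 0 < C₁ :=
  (h.snd_pos hC).trans_le h.le

/-- Since `p_C(1) = (C - H)² ≥ 0`, the point `1` is not strictly between the roots, so `C₁ > 1`
would force `C₂ ≥ 1`. The root sum then gives `HC - H² ≥ 1/2`, the discriminant gives `C² - HC ≤
1/4`, and subtracting makes `(C - H)²` negative. -/
theorem fst_le_one (h : IsFeasible H C C₁ C₂) : C₁ ≤ 1 := by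
  by_contra! h1
  have hsum := h.sum_eq
  have hprod := h.prod_eq
  have hone := h.one_sub_mul_one_sub
  have hH : 0 < H ^ 2 + 1 := by positivity
  have h2 : 1 ≤ C₂ := by
    by_contra! h2
    have : 0 < (H ^ 2 + 1) * ((C₁ - 1) * (1 - C₂)) :=
      mul_pos hH (mul_pos (by linarith) (by linarith))
    nlinarith [sq_nonneg (C - H)]
  have h3 : H ^ 2 + 1 ≤ C ^ 2 := by
    rw [← hprod]
    exact le_mul_of_one_le_right hH.le (by nlinarith)
  have h4 : 2 * (H ^ 2 + 1) ≤ 1 + 2 * H * C := by nlinarith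
  nlinarith [sq_nonneg ((H ^ 2 + 1) * (C₁ - C₂)), sq_nonneg (C - H)]

theorem fst_lt_one (h : IsFeasible H C C₁ C₂) (hCH : C ≠ H) : C₁ < 1 := by
  refine h.fst_le_one.lt_of_ne fun h1 => ?_
  have := h.one_sub_mul_one_sub
  rw [h1] at this
  exact hCH (sub_eq_zero.1 (pow_eq_zero_iff two_ne_zero |>.1 (by linarith)))

theorem ratio_nonneg (h : IsFeasible H C C₁ C₂) : 0 ≤ (C₁ - C₂) / C₁ :=
  div_nonneg (sub_nonneg.2 h.le) (h.nonneg.trans h.le)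

theorem modulus_sq (h : IsFeasible H C C₁ C₂) : modulus C₁ C₂ ^ 2 = (C₁ - C₂) / C₁ :=
  sq_sqrt h.ratio_nonneg

theorem modulus_nonneg (_ : IsFeasible H C C₁ C₂) : 0 ≤ modulus C₁ C₂ := sqrt_nonneg _

theorem modulus_lt_one (h : IsFeasible H C C₁ C₂) (hC : C ≠ 0) : modulus C₁ C₂ < 1 := by
  rw [modulus, sqrt_lt' one_pos, div_lt_iff₀ (h.fst_pos hC)]
  linarith [h.snd_pos hC]

theorem Xi_pos (h : IsFeasible H C C₁ C₂) (hC : C ≠ 0) : 0 < Xi H C₁ :=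
  sqrt_pos.2 (mul_pos (by positivity) (h.fst_pos hC))

theorem Xi_sq (h : IsFeasible H C C₁ C₂) : Xi H C₁ ^ 2 = (H ^ 2 + 1) * C₁ :=
  sq_sqrt (mul_nonneg (by positivity) (h.nonneg.trans h.le))

theorem radius_sq (h : IsFeasible H C C₁ C₂) (hC : C ≠ 0) (t : ℝ) :
    radius H C₁ C₂ t ^ 2 =
      C₁ - (C₁ - C₂) * sin (jacobiAm (modulus C₁ C₂) (Xi H C₁ * t)) ^ 2 := by
  rw [radius, mul_pow, sq_sqrt (h.fst_pos hC).le,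
    jacobiDn_sq h.modulus_nonneg (h.modulus_lt_one hC), h.modulus_sq]
  have := (h.fst_pos hC).ne'
  field_simp

theorem radius_pos (h : IsFeasible H C C₁ C₂) (hC : C ≠ 0) (t : ℝ) : 0 < radius H C₁ C₂ t :=
  mul_pos (sqrt_pos.2 (h.fst_pos hC)) (jacobiDn_pos h.modulus_nonneg (h.modulus_lt_one hC) _)

theorem periodic_radius (h : IsFeasible H C C₁ C₂) (hC : C ≠ 0) :
    Function.Periodic (radius H C₁ C₂) (2 * completeF (modulus C₁ C₂) / Xi H C₁) := fun t => by
  have := (h.Xi_pos hC).ne'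
  rw [radius, radius, mul_add, mul_div_cancel₀ _ this,
    periodic_jacobiDn h.modulus_nonneg (h.modulus_lt_one hC)]

/-- This keeps `1 - k sin²` positive, so the integral of the third kind has no pole. For `C₁ = 1`
the quotient is `0` by convention. -/
theorem parameter_nonpos (h : IsFeasible H C C₁ C₂) : (C₁ - C₂) / (C₁ - 1) ≤ 0 :=
  div_nonpos_of_nonneg_of_nonpos (sub_nonneg.2 h.le) (sub_nonpos.2 h.fst_le_one)

/-- No differential equation enters, so the case `C = H` is covered as well. -/
theorem angle_add (h : IsFeasible H C C₁ C₂) (hC : C ≠ 0) (t : ℝ) :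
    angle H C C₁ C₂ (t + 2 * completeF (modulus C₁ C₂) / Xi H C₁) = angle H C C₁ C₂ t +
      2 * (1 / Xi H C₁ * (completeF (modulus C₁ C₂) * H - (C - H) / (C₁ - 1) *
        completePi (modulus C₁ C₂) ((C₁ - C₂) / (C₁ - 1)))) := by
  have := (h.Xi_pos hC).ne'
  rw [angle, angle, mul_add (Xi H C₁), mul_div_cancel₀ _ this,
    ellipticPi_add_two_completeF h.modulus_nonneg (h.modulus_lt_one hC) h.parameter_nonpos]
  ring

theorem contDiff_radius (h : IsFeasible H C C₁ C₂) (hC : C ≠ 0) :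
    ContDiff ℝ ∞ (radius H C₁ C₂) :=
  contDiff_const.mul ((contDiff_jacobiDn h.modulus_nonneg (h.modulus_lt_one hC)).comp
    (contDiff_const.mul contDiff_id))

theorem one_sub_radius_sq_pos (h : IsFeasible H C C₁ C₂) (hC : C ≠ 0) (hCH : C ≠ H) (t : ℝ) :
    0 < 1 - radius H C₁ C₂ t ^ 2 := by
  rw [h.radius_sq hC]
  nlinarith [h.fst_lt_one hCH, mul_nonneg (sub_nonneg.2 h.le)
    (sq_nonneg (sin (jacobiAm (modulus C₁ C₂) (Xi H C₁ * t))))]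

theorem hasDerivAt_angle (h : IsFeasible H C C₁ C₂) (hC : C ≠ 0) (hCH : C ≠ H) (t : ℝ) :
    HasDerivAt (angle H C C₁ C₂)
      ((C - H * radius H C₁ C₂ t ^ 2) / (1 - radius H C₁ C₂ t ^ 2)) t := by
  have hX := (h.Xi_pos hC).ne'
  have h1 : C₁ - 1 ≠ 0 := (sub_neg.2 (h.fst_lt_one hCH)).ne
  have hlin : ∀ a : ℝ, HasDerivAt (fun t => a * t) a t := fun a => by
    simpa using (hasDerivAt_id t).const_mul a
  have hPi := (hasDerivAt_ellipticPi h.modulus_nonneg (h.modulus_lt_one hC) h.parameter_nonpos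
    (Xi H C₁ * t)).comp t (hlin (Xi H C₁))
  refine ((hlin H).sub (hPi.const_mul ((C - H) / (C₁ - 1) * (1 / Xi H C₁)))).congr_deriv ?_
  have hpos := (h.one_sub_radius_sq_pos hC hCH t).ne'
  -- The parameter `k` is chosen for this identity: it turns `ψ'` into `H + (C - H) / (1 - r²)`.
  have hden : 1 - (C₁ - C₂) / (C₁ - 1) * jacobiSn (modulus C₁ C₂) (Xi H C₁ * t) ^ 2 =
      (1 - radius H C₁ C₂ t ^ 2) / (1 - C₁) := by
    have h2 : 1 - C₁ ≠ 0 := fun h2 => h1 (by linarith)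
    rw [h.radius_sq hC, jacobiSn]
    field_simp
    ring
  rw [hden]
  have h2 : 1 - C₁ ≠ 0 := fun h2 => h1 (by linarith)
  rw [show C₁ - 1 = -(1 - C₁) by ring]
  field_simp
  ring

theorem isDelaunayProfile (h : IsFeasible H C C₁ C₂) (hC : C ≠ 0) (hCH : C ≠ H) :
    ∃ ρ, IsDelaunayProfile H C (radius H C₁ C₂) ρ (angle H C C₁ C₂) := by
  have hp0 := h.modulus_nonneg
  have hp1 := h.modulus_lt_one hC
  have hC₁ := h.fst_pos hC
  have hlin : ∀ t, HasDerivAt (fun t => Xi H C₁ * t) (Xi H C₁) t := fun t => by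
    simpa using (hasDerivAt_id t).const_mul (Xi H C₁)
  refine ⟨fun t => √C₁ * (-modulus C₁ C₂ ^ 2 * sin (jacobiAm (modulus C₁ C₂) (Xi H C₁ * t)) *
    cos (jacobiAm (modulus C₁ C₂) (Xi H C₁ * t)) * Xi H C₁), ?_⟩
  refine ⟨h.contDiff_radius hC, ?_, h.radius_pos hC, ?_, ?_, ?_, ?_, h.hasDerivAt_angle hC hCH⟩
  · rw [contDiff_infty_iff_deriv]
    refine ⟨fun t => (h.hasDerivAt_angle hC hCH t).differentiableAt, ?_⟩
    rw [show deriv (angle H C C₁ C₂) = _ from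
      funext fun t => (h.hasDerivAt_angle hC hCH t).deriv]
    have hr := (h.contDiff_radius hC).pow 2
    exact (contDiff_const.sub (contDiff_const.mul hr)).div (contDiff_const.sub hr)
      fun t => (h.one_sub_radius_sq_pos hC hCH t).ne'
  · intro t
    nlinarith [h.one_sub_radius_sq_pos hC hCH t, h.radius_pos hC t]
  · intro t
    exact ((hasDerivAt_jacobiDn hp0 hp1 _).comp t (hlin t)).const_mul _
  · intro t
    have ham := (hasDerivAt_jacobiAm hp0 hp1 _).comp t (hlin t)
    have hd := (((ham.sin.const_mul (-modulus C₁ C₂ ^ 2)).mul ham.cos).mul_const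
      (Xi H C₁)).const_mul √C₁
    refine hd.congr_deriv ?_
    have hsq := h.radius_sq hC t
    simp only [Function.comp, hsq, ← h.sum_eq]
    rw [radius, h.modulus_sq]
    generalize jacobiDn (modulus C₁ C₂) (Xi H C₁ * t) = d
    generalize jacobiAm (modulus C₁ C₂) (Xi H C₁ * t) = φ
    calc _ = -((C₁ - C₂) / C₁) * Xi H C₁ ^ 2 * (cos φ ^ 2 - sin φ ^ 2) * (√C₁ * d) := by ring
      _ = _ := by
        rw [h.Xi_sq, cos_sq']
        field_simp
        ring
  -- With `r² = C₁ - (C₁ - C₂) sin² am`, this is `r'² = -(H² + 1)(r² - C₁)(r² - C₂)`, written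
  -- through the sum and product of the roots.
  · intro t
    have hsq := h.radius_sq hC t
    have hcos := cos_sq' (jacobiAm (modulus C₁ C₂) (Xi H C₁ * t))
    rw [show radius H C₁ C₂ t ^ 4 = (radius H C₁ C₂ t ^ 2) ^ 2 by ring, hsq, ← h.sum_eq,
      ← h.prod_eq]
    simp only [mul_pow, hcos, sq_sqrt hC₁.le, h.Xi_sq, neg_sq, h.modulus_sq]
    field_simp
    ring

end IsFeasible

theorem surface_eq (H C C₁ C₂ : ℝ) :
    surface H C C₁ C₂ = revolutionSurface (radius H C₁ C₂) (angle H C C₁ C₂) := by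
  ext x i
  simp [surface, revolutionSurface, frameVector]

end DelaunayS3

end

theorem mainTheorem10 (H C C₁ C₂ : ℝ) (hH : 0 ≤ H)
    (hC : DelaunayS3.IsFeasible H C C₁ C₂) (hC0 : C ≠ 0) (n : ℕ)
    (hclosed : |(n : ℝ) / DelaunayS3.Xi H C₁ *
        (DelaunayS3.completeF (DelaunayS3.modulus C₁ C₂) * H
          - (C - H) / (C₁ - 1) *
            DelaunayS3.completePi (DelaunayS3.modulus C₁ C₂) ((C₁ - C₂) / (C₁ - 1)))| = π) :
    ∃ T : ℝ, 0 < T ∧ Function.Periodic (DelaunayS3.profile H C C₁ C₂) T ∧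
      (C < 0 →
        InjOn (DelaunayS3.profile H C C₁ C₂) (Ico 0 T) ∧
        DelaunayS3.IsEmbeddedCMCTorusOfRevolution (DelaunayS3.surface H C C₁ C₂) T H) := by
  open DelaunayS3 in
  set δ := completeF (modulus C₁ C₂) * H - (C - H) / (C₁ - 1) *
    completePi (modulus C₁ C₂) ((C₁ - C₂) / (C₁ - 1)) with hδ
  have hn : (0 : ℝ) < n := by
    rw [Nat.cast_pos, Nat.pos_iff_ne_zero]
    rintro rfl
    simp [pi_ne_zero.symm] at hclosed
  have hX := hC.Xi_pos hC0
  have hT₀ : 0 < 2 * completeF (modulus C₁ C₂) / Xi H C₁ :=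
    div_pos (mul_pos two_pos (completeF_pos hC.modulus_nonneg (hC.modulus_lt_one hC0))) hX
  have hr := (hC.periodic_radius hC0).nat_mul n
  have hψ₀ : ∀ (m : ℕ) t, angle H C C₁ C₂ (t + m * (2 * completeF (modulus C₁ C₂) / Xi H C₁)) =
      angle H C C₁ C₂ t + 2 * (m / Xi H C₁ * δ) := by
    intro m
    induction m with
    | zero => simp
    | succ m ih =>
      intro t
      rw [Nat.cast_succ, add_mul, ← add_assoc, one_mul, hC.angle_add hC0, ih, ← hδ]
      ring
  have hψ := hψ₀ n
  have hT := mul_pos hn hT₀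
  generalize (n : ℝ) * (2 * completeF (modulus C₁ C₂) / Xi H C₁) = T at *
  refine ⟨T, hT, fun t => ?_, fun hneg => ?_⟩
  · rcases (abs_eq pi_nonneg).1 hclosed with h | h <;> rw [h] at hψ
    · simp [profile, surface, hr t, hψ]
    · rw [mul_neg] at hψ
      simp [profile, surface, hr t, hψ, ← sub_eq_add_neg]
  -- Here `C < 0 ≤ H` excludes `C = H`, so `r < 1` everywhere and the differential equations are
  -- available.
  · obtain ⟨ρ, hD⟩ := hC.isDelaunayProfile hC0 (hneg.trans_le hH).ne
    have hanti := hD.strictAnti_ψ hH hneg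
    have hψ' : ∀ t, angle H C C₁ C₂ (t + T) = angle H C C₁ C₂ t - 2 * π := by
      rcases (abs_eq pi_nonneg).1 hclosed with h | h <;> rw [h] at hψ
      -- A gain of `+2π` contradicts the strict decrease of `ψ`; only `-2π` survives.
      · have h1 := hanti (lt_add_of_pos_right 0 hT)
        rw [hψ] at h1
        linarith [pi_pos]
      · intro t
        rw [hψ]
        ring
    rw [surface_eq]
    refine ⟨fun t ht t' ht' heq => ?_, hD.isEmbeddedCMCTorusOfRevolution hanti hT hr hψ'⟩
    rw [profile, profile, surface_eq] at heq
    have : Fact (0 < T) := ⟨hT⟩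
    -- Injectivity of the profile is the case `θ = θ' = 0` of injectivity on the torus, read on the
    -- fundamental domain `[0, T)`.
    exact (AddCircle.coe_eq_coe_iff_of_mem_Ico (a := 0) (by simpa using ht)
      (by simpa using ht')).1 (hD.eq_of_surface_eq hanti hT.ne' hψ' heq).2
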